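/- Let $d\ge 2$ and $k\ge 0$ be integers with $2k<d$, let $\sigma,T>0$, and put $\sigma'=\sqrt{d/(d-2k)}\,\sigma$. Let $\mathcal P=\mathcal N^{\mathsf g}(k,\sigma)$ be the probability distribution on $\mathbb R^d$ whose density $p$ is proportional to $\|\varepsilon\|_2^{-2k}\exp(-\|\varepsilon\|_2^2/(2\sigma'^2))$, and let $\mathcal Q=\mathcal N^{\mathsf g}_{\mathsf{trunc}}(k,T,\sigma)$ be the probability distribution whose density $q$ is proportional to $\|\varepsilon\|_2^{-2k}\exp(-\|\varepsilon\|_2^2/(2\sigma'^2))\,\mathbf 1[\|\varepsilon\|_2\le T]$. Let $\nu = 1/\Gamma\mathrm{CDF}_{d/2-k}\big(T^2/(2\sigma'^2)\big)$, where $\Gamma\mathrm{CDF}_a$ is the cumulative distribution function of the Gamma distribution with shape $a$ and rate $1$. For $\delta\in\mathbb R^d\setminus\{0\}$ and $\lambda_1,\lambda_2\in\mathbb R$ let $$P(\lambda_1,\lambda_2)=\Pr_{\varepsilon\sim\mathcal P}\big[p(\varepsilon-\delta)<\lambda_1p(\varepsilon)+\lambda_2q(\varepsilon)\big],\qquad Q(\lambda_1,\lambda_2)=\Pr_{\varepsilon\sim\mathcal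 Q}\big[p(\varepsilon-\delta)<\lambda_1p(\varepsilon)+\lambda_2q(\varepsilon)\big].$$ If $Q_A\in(0,1)$ and $P_A\in\big(Q_A/\nu,\;1-(1-Q_A)/\nu\big)$, then there is exactly one pair $(\lambda_1,\lambda_2)\in\mathbb R^2$ with $P(\lambda_1,\lambda_2)=P_A$ and $Q(\lambda_1,\lambda_2)=Q_A$. -/

import Mathlib

open MeasureTheory ProbabilityTheory

namespace DSRS

/-- The rescaled standard deviation `σ' = √(d / (d - 2k)) σ`. -/
noncomputable def sigmaPrime (d k : ℕ) (σ : ℝ) : ℝ :=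
  Real.sqrt ((d : ℝ) / ((d : ℝ) - 2 * (k : ℝ))) * σ

/-- The unnormalised density `‖x‖^(-2k) exp(-‖x‖² / (2σ'²))` of the generalized Gaussian. -/
noncomputable def weight (d k : ℕ) (σ : ℝ) (x : EuclideanSpace ℝ (Fin d)) : ℝ :=
  (‖x‖ ^ (2 * k))⁻¹ * Real.exp (-(‖x‖ ^ 2 / (2 * sigmaPrime d k σ ^ 2)))

/-- The unnormalised density restricted to the closed ball of radius `T` about the origin. -/
noncomputable def truncWeight (d k : ℕ) (T σ : ℝ) : EuclideanSpace ℝ (Fin d) → ℝ :=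
  Set.indicator (Metric.closedBall 0 T) (weight d k σ)

/-- The density `p` of the generalized Gaussian `𝒩ᵍ(k, σ)` on `ℝᵈ`. -/
noncomputable def pDensity (d k : ℕ) (σ : ℝ) (x : EuclideanSpace ℝ (Fin d)) : ℝ :=
  weight d k σ x / ∫ y, weight d k σ y

/-- The density `q` of the truncated generalized Gaussian `𝒩ᵍ_trunc(k, T, σ)` on `ℝᵈ`. -/
noncomputable def qDensity (d k : ℕ) (T σ : ℝ) (x : EuclideanSpace ℝ (Fin d)) : ℝ :=
  truncWeight d k T σ x / ∫ y, truncWeight d k T σ y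

/-- The generalized Gaussian distribution `𝒩ᵍ(k, σ)` on `ℝᵈ`. -/
noncomputable def genGaussian (d k : ℕ) (σ : ℝ) : Measure (EuclideanSpace ℝ (Fin d)) :=
  volume.withDensity fun x => ENNReal.ofReal (pDensity d k σ x)

/-- The truncated generalized Gaussian distribution `𝒩ᵍ_trunc(k, T, σ)` on `ℝᵈ`. -/
noncomputable def truncGenGaussian (d k : ℕ) (T σ : ℝ) :
    Measure (EuclideanSpace ℝ (Fin d)) :=
  volume.withDensity fun x => ENNReal.ofReal (qDensity d k T σ x)

/-- `ν = 1 / ΓCDF_{d/2-k}(T² / (2σ'²))`, with `ΓCDF_a` the distribution function of the Gamma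
distribution of shape `a` and rate `1`. -/
noncomputable def nu (d k : ℕ) (T σ : ℝ) : ℝ :=
  (cdf (gammaMeasure ((d : ℝ) / 2 - (k : ℝ)) 1) (T ^ 2 / (2 * sigmaPrime d k σ ^ 2)))⁻¹

/-- The event `p(ε - δ) < λ₁ p(ε) + λ₂ q(ε)`. -/
def event (d k : ℕ) (T σ : ℝ) (δ : EuclideanSpace ℝ (Fin d)) (l₁ l₂ : ℝ) :
    Set (EuclideanSpace ℝ (Fin d)) :=
  {x | pDensity d k σ (x - δ) < l₁ * pDensity d k σ x + l₂ * qDensity d k T σ x}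

/-- `P(λ₁, λ₂)`: the probability of the event when the noise follows `𝒩ᵍ(k, σ)`. -/
noncomputable def constraintP (d k : ℕ) (T σ : ℝ) (δ : EuclideanSpace ℝ (Fin d))
    (l₁ l₂ : ℝ) : ℝ :=
  (genGaussian d k σ).real (event d k T σ δ l₁ l₂)

/-- `Q(λ₁, λ₂)`: the probability of the event when the noise follows `𝒩ᵍ_trunc(k, T, σ)`. -/
noncomputable def constraintQ (d k : ℕ) (T σ : ℝ) (δ : EuclideanSpace ℝ (Fin d))
    (l₁ l₂ : ℝ) : ℝ :=
  (truncGenGaussian d k T σ).real (event d k T σ δ l₁ l₂)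

end DSRS

/-! Let `r(x) = p(x - δ) / p(x)` and let `B` be the closed ball of radius `T`. Since `q = ν p` on
`B` and `q = 0` off `B`, the event is, up to a null set, `r < λ₁ + ν λ₂` on `B` and `r < λ₁` on
`Bᶜ`. So the two constraints decouple: with `a = λ₁ + ν λ₂` and `b = λ₁`, they say that `B ∩ {r <
a}` has `𝒫`-mass `QA / ν` and `Bᶜ ∩ {r < b}` has `𝒫`-mass `PA - QA / ν`. The bounds on `PA` and `QA`
place these targets strictly between `0` and the masses `1 / ν` and `1 - 1 / ν` of the regions.

Each threshold exists because level sets of `r` are null (`ae_invWeight_ne`), by analyticity along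
lines parallel to `δ`. It is unique because each region is connected, the exterior thanks to `d ≥
2`: `r` cannot skip an interval of values (`existsUnique_likelihoodRatio_threshold`). -/

namespace DSRS

open Filter Topology

/-! ### Thresholds of a real function under a finite measure -/

/-- A finite atomless measure on the line takes every intermediate value on a left half-line. -/
lemma exists_measureReal_Iio_eq (ρ : Measure ℝ) [IsFiniteMeasure ρ] (hρ : ∀ a, ρ {a} = 0)
    {c : ℝ} (hc : c ∈ Set.Ioo 0 (ρ.real Set.univ)) : ∃ a, ρ.real (Set.Iio a) = c := by
  have hpos : 0 < ρ.real Set.univ := hc.1.trans hc.2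
  have : NeZero ρ := ⟨by rintro rfl; simp at hpos⟩
  set ρ' : Measure ℝ := (ρ Set.univ)⁻¹ • ρ with hρ'
  have hprob : IsProbabilityMeasure ρ' := inferInstance
  have hatom : ∀ a, ρ' {a} = 0 := fun a => by simp [hρ', hρ a]
  have hcont : Continuous (cdf ρ') := by
    refine continuous_iff_continuousAt.2 fun a => ?_
    have h1 := (cdf ρ').measure_singleton a
    -- The mass of an atom is the jump of the cdf, so there is no jump.
    rw [measure_cdf, hatom a] at h1
    have h2 : cdf ρ' a ≤ Function.leftLim (cdf ρ') a :=
      sub_nonpos.1 (ENNReal.ofReal_eq_zero.1 h1.symm)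
    have h3 := le_antisymm ((monotone_cdf ρ').leftLim_le le_rfl) h2
    refine continuousAt_iff_continuous_left_right.2 ⟨?_, (cdf ρ').right_continuous a⟩
    exact continuousWithinAt_Iio_iff_Iic.1 <| ((monotone_cdf ρ').continuousWithinAt_Iio_iff_leftLim_eq).2 h3
  have hc' : c / ρ.real Set.univ ∈ Set.Ioo (0 : ℝ) 1 :=
    ⟨div_pos hc.1 hpos, (div_lt_one hpos).2 hc.2⟩
  obtain ⟨a, ha⟩ : ∃ a, cdf ρ' a = c / ρ.real Set.univ :=
    mem_range_of_exists_le_of_exists_ge hcont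
      (((tendsto_cdf_atBot ρ').eventually_le_const hc'.1).exists)
      (((tendsto_cdf_atTop ρ').eventually_const_le hc'.2).exists)
  refine ⟨a, ?_⟩
  have h4 : ρ.real (Set.Iio a) = ρ.real (Set.Iic a) :=
    measureReal_congr (Iio_ae_eq_Iic' (hρ a))
  rw [cdf_eq_real, hρ', measureReal_ennreal_smul_apply, ENNReal.toReal_inv] at ha
  rw [h4]
  change (ρ.real Set.univ)⁻¹ * _ = _ at ha
  field_simp at ha
  exact ha

/-- If the sublevel sets of `f` have continuously and strictly increasing measure, each
intermediate value is the measure of exactly one sublevel set. -/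
lemma existsUnique_measureReal_sublevel {α : Type*} [MeasurableSpace α] (μ : Measure α)
    [IsFiniteMeasure μ] {f : α → ℝ} (hf : Measurable f) (hlevel : ∀ a, μ {x | f x = a} = 0)
    (hgap : ∀ a b, a < b → μ {x | f x < a} ≠ 0 → μ {x | b ≤ f x} ≠ 0 →
      μ {x | a ≤ f x ∧ f x < b} ≠ 0)
    {c : ℝ} (hc : c ∈ Set.Ioo 0 (μ.real Set.univ)) : ∃! a, μ.real {x | f x < a} = c := by
  have hmeas : ∀ a, MeasurableSet {x | f x < a} := fun a => hf measurableSet_Iio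
  refine existsUnique_of_exists_of_unique ?_ ?_
  · obtain ⟨a, ha⟩ := exists_measureReal_Iio_eq (μ.map f)
      (fun a => by rw [Measure.map_apply hf (measurableSet_singleton a)]; exact hlevel a)
      (c := c) (by rwa [map_measureReal_apply hf MeasurableSet.univ])
    exact ⟨a, by rwa [map_measureReal_apply hf measurableSet_Iio] at ha⟩
  · have key : ∀ a b, a < b → μ.real {x | f x < a} = c → μ.real {x | f x < b} = c → False := by
      intro a b hab ha hb
      refine hgap a b hab ?_ ?_ ?_
      · intro h
        rw [measureReal_def, h] at ha
        exact hc.1.ne ha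
      · intro h
        have h1 := measureReal_add_measureReal_compl (μ := μ) (hmeas b)
        have h2 : {x | f x < b}ᶜ = {x | b ≤ f x} := by ext; simp
        rw [h2, measureReal_def μ {x | b ≤ f x}, h, hb] at h1
        simp only [ENNReal.toReal_zero, add_zero] at h1
        exact hc.2.ne h1
      · have h1 : {x | a ≤ f x ∧ f x < b} = {x | f x < b} \ {x | f x < a} := by
          ext x; simp [and_comm]
        have h2 := measureReal_sdiff (μ := μ) (s₁ := {x | f x < b}) (s₂ := {x | f x < a})
          (fun x (hx : f x < a) => hx.trans hab) (hmeas a)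
        rw [ha, hb, sub_self] at h2
        rw [h1]
        exact (measureReal_eq_zero_iff).1 h2
    intro a b ha hb
    rcases lt_trichotomy a b with h | h | h
    · exact (key a b h ha hb).elim
    · exact h
    · exact (key b a h hb ha).elim

/-! ### Level sets of the likelihood ratio are null -/

section InvWeight

variable {E : Type*} [NormedAddCommGroup E]

/-- The continuous function `‖x‖^(2k) exp(‖x‖² / (2s²))`, whose inverse is the unnormalised
density of the generalized Gaussian. -/
noncomputable def invWeight (k : ℕ) (s : ℝ) (x : E) : ℝ :=
  ‖x‖ ^ (2 * k) * Real.exp (‖x‖ ^ 2 / (2 * s ^ 2))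

lemma invWeight_nonneg (k : ℕ) (s : ℝ) (x : E) : 0 ≤ invWeight k s x := by
  unfold invWeight; positivity

lemma invWeight_pos (k : ℕ) (s : ℝ) {x : E} (hx : x ≠ 0) : 0 < invWeight k s x := by
  have := norm_pos_iff.2 hx
  unfold invWeight; positivity

lemma continuous_invWeight (k : ℕ) (s : ℝ) : Continuous (invWeight k s : E → ℝ) := by
  unfold invWeight; fun_prop

lemma invWeight_lt_invWeight (k : ℕ) {s : ℝ} (hs : 0 < s) {x y : E} (h : ‖x‖ < ‖y‖) :
    invWeight k s x < invWeight k s y := by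
  have hy : 0 < ‖y‖ := (norm_nonneg x).trans_lt h
  unfold invWeight
  have h2 : Real.exp (‖x‖ ^ 2 / (2 * s ^ 2)) < Real.exp (‖y‖ ^ 2 / (2 * s ^ 2)) := by
    gcongr
  exact mul_lt_mul_of_le_of_lt_of_nonneg_of_pos (by gcongr) h2 (by positivity) (by positivity)

variable [InnerProductSpace ℝ E]

lemma norm_add_smul_sq (y δ : E) (t : ℝ) :
    ‖y + t • δ‖ ^ 2 = ‖y‖ ^ 2 + 2 * (t * inner ℝ y δ) + t ^ 2 * ‖δ‖ ^ 2 := by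
  rw [norm_add_sq_real, inner_smul_right, norm_smul, mul_pow, Real.norm_eq_abs, sq_abs]

/-- Only `‖x‖ ^ 2` enters, and it is quadratic in `t`; so analyticity persists even where the line
meets the origin. -/
lemma analyticAt_invWeight_line (k : ℕ) (s : ℝ) (y δ : E) (t : ℝ) :
    AnalyticAt ℝ (fun t : ℝ => invWeight k s (y + t • δ)) t := by
  simp only [invWeight, pow_mul, norm_add_smul_sq, div_eq_mul_inv]
  fun_prop

/-- Along no line parallel to `δ` is `invWeight` geometric under translation by `δ`. -/
lemma exists_invWeight_line_ne (k : ℕ) {s : ℝ} (hs : 0 < s) (y : E) {δ : E} (hδ : δ ≠ 0)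
    (a : ℝ) : ∃ t : ℝ, invWeight k s (y + t • δ) ≠ a * invWeight k s (y + t • δ - δ) := by
  by_contra! h
  have hD : 0 < ‖δ‖ ^ 2 := by have := norm_pos_iff.2 hδ; positivity
  -- `z = y + t₀ • δ` is the point of the line nearest the origin, so `z - δ` and `z + δ` are both
  -- strictly longer than `z`. The relation at `z` then forces `a < 1`, while at `z + δ` it is
  -- incompatible with `a < 1`.
  set t₀ : ℝ := -(inner ℝ y δ / ‖δ‖ ^ 2) with ht₀
  have ht : t₀ * ‖δ‖ ^ 2 = -inner ℝ y δ := by rw [ht₀]; field_simp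
  set z := y + t₀ • δ with hz
  have e1 : y + (t₀ + 1) • δ = z + δ := by rw [hz]; module
  have hzδ : inner ℝ z δ = 0 := by
    rw [hz, inner_add_left, inner_smul_left, real_inner_self_eq_norm_sq]
    simp only [conj_trivial]; linarith
  have h1 := h t₀
  have h2 := h (t₀ + 1)
  rw [e1, add_sub_cancel_right] at h2
  rw [← hz] at h1
  have hn1 : ‖z‖ < ‖z - δ‖ := by
    refine lt_of_pow_lt_pow_left₀ 2 (norm_nonneg _) ?_
    rw [norm_sub_sq_real, hzδ]; linarith
  have hn2 : ‖z‖ < ‖z + δ‖ := by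
    refine lt_of_pow_lt_pow_left₀ 2 (norm_nonneg _) ?_
    rw [norm_add_sq_real z δ, hzδ]; linarith
  have k1 := invWeight_lt_invWeight k hs hn1
  have k2 := invWeight_lt_invWeight k hs hn2
  have k0 := invWeight_nonneg k s z
  have ha : a < 1 := by
    by_contra! ha
    nlinarith
  nlinarith

variable [FiniteDimensional ℝ E] [MeasurableSpace E] [BorelSpace E]

/-- By Fubini it suffices to treat each line parallel to `δ`. There both sides are analytic and not
identical, so they agree only on a discrete, hence null, set. -/
lemma ae_invWeight_ne (μ : Measure E) [μ.IsAddHaarMeasure] (k : ℕ) {s : ℝ} (hs : 0 < s)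
    {δ : E} (hδ : δ ≠ 0) (a : ℝ) :
    ∀ᵐ x ∂μ, invWeight k s x ≠ a * invWeight k s (x - δ) := by
  have hc := continuous_invWeight (E := E) k s
  have hc' : Continuous fun x : E => a * invWeight k s (x - δ) :=
    continuous_const.mul (hc.comp (continuous_sub_right δ))
  have hm : MeasurableSet {x : E | invWeight k s x ≠ a * invWeight k s (x - δ)} :=
    (isClosed_eq hc hc').measurableSet.compl
  refine ae_mem_of_ae_add_linearMap_mem (LinearMap.toSpanSingleton ℝ E δ) volume μ hm fun y => ?_
  simp only [LinearMap.toSpanSingleton_apply]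
  have hf : AnalyticOnNhd ℝ (fun t : ℝ => invWeight k s (y + t • δ)) Set.univ :=
    fun t _ => analyticAt_invWeight_line k s y δ t
  have hg : AnalyticOnNhd ℝ (fun t : ℝ => a * invWeight k s (y + t • δ - δ)) Set.univ := by
    intro t _
    have := analyticAt_invWeight_line k s (y - δ) δ t
    have e : ∀ t : ℝ, y + t • δ - δ = y - δ + t • δ := fun t => by module
    simp only [e]
    exact analyticAt_const.mul this
  rcases hf.eqOn_or_eventually_ne_of_preconnected hg isPreconnected_univ with h | h
  · obtain ⟨t, ht⟩ := exists_invWeight_line_ne k hs y hδ a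
    exact (ht (h (Set.mem_univ t))).elim
  · have := ae_restrict_le_codiscreteWithin (μ := (volume : Measure ℝ)) MeasurableSet.univ h
    rwa [Measure.restrict_univ] at this

end InvWeight

/-! ### Connectedness of the exterior of a ball -/

section Connected

variable {E : Type*} [NormedAddCommGroup E] [NormedSpace ℝ E]

/-- Pushing every point radially outwards by `T` maps the punctured space, connected in dimension
above one, continuously onto the exterior. -/
lemma isPreconnected_compl_closedBall (h : 1 < Module.rank ℝ E) {T : ℝ} (hT : 0 ≤ T) :
    IsPreconnected (Metric.closedBall (0 : E) T)ᶜ := by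
  have key : (Metric.closedBall (0 : E) T)ᶜ = (fun x : E => (1 + T / ‖x‖) • x) '' {0}ᶜ := by
    ext x
    simp only [Set.mem_compl_iff, Metric.mem_closedBall, dist_zero_right, not_le, Set.mem_image,
      Set.mem_singleton_iff]
    constructor
    · intro hx
      have hx0 : 0 < ‖x‖ := hT.trans_lt hx
      have hpos : 0 < 1 - T / ‖x‖ := by
        rw [sub_pos, div_lt_one hx0]; exact hx
      refine ⟨(1 - T / ‖x‖) • x, ?_, ?_⟩
      · exact smul_ne_zero hpos.ne' (norm_pos_iff.1 hx0)
      · have hsub : ‖x‖ - T ≠ 0 := by linarith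
        rw [norm_smul, Real.norm_of_nonneg hpos.le, smul_smul]
        have : (1 + T / ((1 - T / ‖x‖) * ‖x‖)) * (1 - T / ‖x‖) = 1 := by
          have e : (1 - T / ‖x‖) * ‖x‖ = ‖x‖ - T := by field_simp
          rw [e]; field_simp; ring
        rw [this, one_smul]
    · rintro ⟨y, hy, rfl⟩
      have hy0 := norm_pos_iff.2 hy
      rw [norm_smul, Real.norm_of_nonneg (by positivity), add_mul, div_mul_cancel₀ _ hy0.ne']
      linarith
  rw [key]
  refine (isConnected_compl_singleton_of_one_lt_rank h (0 : E)).isPreconnected.image _ ?_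
  refine ContinuousOn.smul (continuousOn_const.add (continuousOn_const.div
    continuous_norm.continuousOn fun x hx => norm_ne_zero_iff.2 hx)) continuousOn_id

end Connected

/-! ### Normalising constants as Gamma integrals -/

lemma sigmaPrime_pos {d k : ℕ} (hk : 2 * k < d) {σ : ℝ} (hσ : 0 < σ) : 0 < sigmaPrime d k σ := by
  have h : (2 * k : ℝ) < d := by exact_mod_cast hk
  have h0 : (0 : ℝ) ≤ k := k.cast_nonneg
  exact mul_pos (Real.sqrt_pos.2 (div_pos (by linarith) (by linarith))) hσ

/-- Polar coordinates for the generalized Gaussian, in terms of `u = ‖x‖² / (2σ'²)`. -/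
lemma exists_integral_weight_mul {d k : ℕ} (hk : 2 * k < d) {σ : ℝ} (hσ : 0 < σ) :
    ∃ C : ℝ, 0 < C ∧ ∀ h : ℝ → ℝ,
      ∫ x, weight d k σ x * h (‖x‖ ^ 2 / (2 * sigmaPrime d k σ ^ 2)) =
        C * ∫ u in Set.Ioi (0 : ℝ), u ^ ((d : ℝ) / 2 - k - 1) * Real.exp (-u) * h u := by
  have hs := sigmaPrime_pos hk hσ
  set s := sigmaPrime d k σ with hsdef
  set b : ℝ := (2 * s ^ 2)⁻¹ with hb
  have hbpos : 0 < b := by positivity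
  set V : ℝ := volume.real (Metric.ball (0 : EuclideanSpace ℝ (Fin d)) 1)
  have hV : 0 < V := ENNReal.toReal_pos
    (Metric.measure_ball_pos volume _ one_pos).ne' measure_ball_lt_top.ne
  have hd : 0 < d := by omega
  have : Nonempty (Fin d) := ⟨⟨0, hd⟩⟩
  set a : ℝ := (d : ℝ) / 2 - k
  have hba : 0 < b ^ (a - 1) := Real.rpow_pos_of_pos hbpos _
  -- `d * V` is the area of the unit sphere; the other factors come from the substitution `u = b * y
  -- ^ 2`.
  refine ⟨d * V * ((2 * b ^ (a - 1))⁻¹ * b⁻¹), by positivity, fun h => ?_⟩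
  have h1 := integral_fun_norm_addHaar (volume : Measure (EuclideanSpace ℝ (Fin d)))
    (fun y : ℝ => (y ^ (2 * k))⁻¹ * Real.exp (-(y ^ 2 / (2 * s ^ 2))) * h (y ^ 2 / (2 * s ^ 2)))
  rw [finrank_euclideanSpace_fin] at h1
  simp only [weight, ← hsdef]
  rw [h1, nsmul_eq_mul, smul_eq_mul]
  set G : ℝ → ℝ := fun u => u ^ (a - 1) * Real.exp (-u) * h u with hG
  have h2 := integral_comp_mul_left_Ioi G 0 hbpos
  rw [mul_zero, ← integral_comp_rpow_Ioi_of_pos (g := fun x => G (b * x)) two_pos,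
    smul_eq_mul] at h2
  have h3 : ∫ x in Set.Ioi (0 : ℝ), (2 * x ^ ((2 : ℝ) - 1)) • G (b * x ^ (2 : ℝ)) =
      (2 * b ^ (a - 1)) * ∫ y in Set.Ioi (0 : ℝ), y ^ (d - 1) • ((y ^ (2 * k))⁻¹ *
        Real.exp (-(y ^ 2 / (2 * s ^ 2))) * h (y ^ 2 / (2 * s ^ 2))) := by
    rw [← integral_const_mul]
    refine setIntegral_congr_fun measurableSet_Ioi fun y (hy : 0 < y) => ?_
    have e1 : b * y ^ (2 : ℝ) = y ^ 2 / (2 * s ^ 2) := by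
      rw [hb, Real.rpow_two, div_eq_inv_mul]
    have e2 : (y ^ 2 / (2 * s ^ 2)) ^ (a - 1) = b ^ (a - 1) * y ^ (2 * (a - 1)) := by
      rw [← e1, Real.mul_rpow hbpos.le (by positivity), ← Real.rpow_mul hy.le]
    have e3 : y ^ ((2 : ℝ) - 1) * y ^ (2 * (a - 1)) = y ^ (d - 1) * (y ^ (2 * k))⁻¹ := by
      rw [← Real.rpow_add hy, ← Real.rpow_natCast, ← Real.rpow_natCast, ← Real.rpow_neg hy.le,
        ← Real.rpow_add hy]
      congr 1
      push_cast [Nat.cast_sub (show 1 ≤ d by omega)]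
      ring
    simp only [hG, smul_eq_mul, e1, e2]
    linear_combination 2 * b ^ (a - 1) * Real.exp (-(y ^ 2 / (2 * s ^ 2))) *
      h (y ^ 2 / (2 * s ^ 2)) * e3
  rw [h3] at h2
  have h4 : (2 * b ^ (a - 1)) ≠ 0 := by positivity
  rw [mul_assoc ((d : ℝ) * V), mul_assoc (2 * b ^ (a - 1))⁻¹, ← h2, inv_mul_cancel_left₀ h4,
    mul_assoc]

variable {d k : ℕ} {σ : ℝ}

lemma weight_nonneg (x : EuclideanSpace ℝ (Fin d)) : 0 ≤ weight d k σ x := by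
  unfold weight; positivity

lemma measurable_weight : Measurable (weight d k σ) := by
  unfold weight; fun_prop

lemma shape_pos (hk : 2 * k < d) : 0 < (d : ℝ) / 2 - k := by
  have h : (2 * k : ℝ) < d := by exact_mod_cast hk
  linarith

lemma integral_weight_pos (hk : 2 * k < d) (hσ : 0 < σ) : 0 < ∫ x, weight d k σ x := by
  obtain ⟨C, hC, h⟩ := exists_integral_weight_mul hk hσ
  have := h 1
  simp only [Pi.one_apply, mul_one] at this
  have h2 := Real.Gamma_eq_integral (shape_pos hk)
  simp only [mul_comm (Real.exp _)] at h2
  rw [this, ← h2]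
  exact mul_pos hC (Real.Gamma_pos_of_pos (shape_pos hk))

/-- A non-integrable function has integral `0` by convention, so positivity of the integral
suffices. -/
lemma integrable_weight (hk : 2 * k < d) (hσ : 0 < σ) : Integrable (weight d k σ) :=
  not_imp_comm.1 integral_undef (integral_weight_pos hk hσ).ne'

lemma integral_truncWeight_div (hk : 2 * k < d) (hσ : 0 < σ) {T : ℝ} (hT : 0 < T) :
    (∫ x, truncWeight d k T σ x) / ∫ x, weight d k σ x =
      cdf (gammaMeasure ((d : ℝ) / 2 - k) 1) (T ^ 2 / (2 * sigmaPrime d k σ ^ 2)) := by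
  have hs := sigmaPrime_pos hk hσ
  have ha := shape_pos hk
  obtain ⟨C, hC, h⟩ := exists_integral_weight_mul hk hσ
  have h1 := h 1
  simp only [Pi.one_apply, mul_one] at h1
  have h2 := Real.Gamma_eq_integral ha
  simp only [mul_comm (Real.exp _)] at h2
  set s := sigmaPrime d k σ
  set U := T ^ 2 / (2 * s ^ 2) with hU
  -- In the variable `u` the ball of radius `T` is the half-line `u ≤ U`.
  have h3 := h ((Set.Iic U).indicator 1)
  have h4 : ∀ x, weight d k σ x * (Set.Iic U).indicator 1 (‖x‖ ^ 2 / (2 * s ^ 2)) =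
      truncWeight d k T σ x := by
    intro x
    have : ‖x‖ ^ 2 / (2 * s ^ 2) ≤ U ↔ ‖x‖ ≤ T := by
      rw [hU, div_le_div_iff_of_pos_right (by positivity),
        pow_le_pow_iff_left₀ (norm_nonneg x) hT.le two_ne_zero]
    by_cases hx : ‖x‖ ≤ T
    · simp [truncWeight, hx, this.2 hx]
    · simp only [truncWeight, Set.indicator, Set.mem_Iic, this, hx, Metric.mem_closedBall,
        dist_zero_right, if_false, mul_zero]
  simp only [h4] at h3
  rw [cdf_gammaMeasure_eq_integral ha one_pos, h1, h3, ← h2, mul_div_mul_left _ _ hC.ne',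
    ← integral_indicator measurableSet_Ioi, ← integral_indicator measurableSet_Iic,
    ← integral_div]
  refine integral_congr_ae ?_
  filter_upwards [compl_mem_ae_iff.2 (measure_singleton (0 : ℝ))] with u hu
  have hu : u ≠ 0 := hu
  rcases lt_or_gt_of_ne hu with hu | hu
  · simp [Set.indicator, gammaPDFReal, hu.not_ge, hu.not_gt]
  · by_cases huU : u ≤ U
    · simp [Set.indicator, gammaPDFReal, hu.le, hu, huU]; ring
    · simp [Set.indicator, huU]

/-! ### The two distributions and their densities -/

lemma pDensity_nonneg (x : EuclideanSpace ℝ (Fin d)) : 0 ≤ pDensity d k σ x :=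
  div_nonneg (weight_nonneg x) (integral_nonneg weight_nonneg)

lemma measurable_pDensity : Measurable (pDensity d k σ) :=
  measurable_weight.div_const _

lemma integrable_pDensity (hk : 2 * k < d) (hσ : 0 < σ) : Integrable (pDensity d k σ) :=
  (integrable_weight hk hσ).div_const _

lemma isProbabilityMeasure_genGaussian (hk : 2 * k < d) (hσ : 0 < σ) :
    IsProbabilityMeasure (genGaussian d k σ) := by
  constructor
  rw [genGaussian, withDensity_apply _ MeasurableSet.univ, Measure.restrict_univ,
    ← ofReal_integral_eq_lintegral_ofReal (integrable_pDensity hk hσ)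
      (ae_of_all _ pDensity_nonneg)]
  simp only [pDensity]
  rw [integral_div, div_self (integral_weight_pos hk hσ).ne', ENNReal.ofReal_one]

lemma genGaussian_closedBall (hk : 2 * k < d) (hσ : 0 < σ) {T : ℝ} (hT : 0 < T) :
    (genGaussian d k σ).real (Metric.closedBall 0 T) = (nu d k T σ)⁻¹ := by
  rw [nu, inv_inv, ← integral_truncWeight_div hk hσ hT, genGaussian, measureReal_def,
    withDensity_apply _ Metric.isClosed_closedBall.measurableSet,
    ← ofReal_integral_eq_lintegral_ofReal (integrable_pDensity hk hσ).integrableOn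
      (ae_of_all _ pDensity_nonneg),
    ENNReal.toReal_ofReal (integral_nonneg pDensity_nonneg)]
  simp only [pDensity, truncWeight]
  rw [integral_div, integral_indicator Metric.isClosed_closedBall.measurableSet]

lemma measure_genGaussian_pos_of_isOpen (hk : 2 * k < d) (hσ : 0 < σ)
    {U : Set (EuclideanSpace ℝ (Fin d))} (hU : IsOpen U) (hne : U.Nonempty) :
    genGaussian d k σ U ≠ 0 := by
  have : Nontrivial (EuclideanSpace ℝ (Fin d)) := by
    have : Nonempty (Fin d) := ⟨⟨0, by omega⟩⟩
    infer_instance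
  intro h
  rw [genGaussian, withDensity_apply_eq_zero measurable_pDensity.ennreal_ofReal] at h
  refine (hU.measure_pos volume hne).ne' (measure_mono_null_ae ?_ h)
  -- The origin is dropped: for `k > 0` the density vanishes there, as `0⁻¹ = 0`.
  filter_upwards [compl_mem_ae_iff.2 (measure_singleton (0 : EuclideanSpace ℝ (Fin d)))]
    with x hx hxU
  have hx : 0 < ‖x‖ := norm_pos_iff.2 hx
  have hp : 0 < pDensity d k σ x :=
    div_pos (by unfold weight; positivity) (integral_weight_pos hk hσ)
  exact ⟨(ENNReal.ofReal_pos.2 hp).ne', hxU⟩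

lemma genGaussian_absolutelyContinuous : genGaussian d k σ ≪ volume :=
  withDensity_absolutelyContinuous _ _

lemma genGaussian_closedBall_pos (hk : 2 * k < d) (hσ : 0 < σ) {T : ℝ} (hT : 0 < T) :
    0 < (genGaussian d k σ).real (Metric.closedBall 0 T) := by
  have := isProbabilityMeasure_genGaussian hk hσ
  refine ENNReal.toReal_pos (fun h => ?_) (measure_ne_top _ _)
  exact measure_genGaussian_pos_of_isOpen hk hσ Metric.isOpen_ball (Metric.nonempty_ball.2 hT)
    (measure_mono_null Metric.ball_subset_closedBall h)

/-- The truncated density is the density of the conditioned distribution. -/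
lemma qDensity_eq (hk : 2 * k < d) (hσ : 0 < σ) {T : ℝ} (hT : 0 < T)
    (x : EuclideanSpace ℝ (Fin d)) :
    qDensity d k T σ x =
      (Metric.closedBall 0 T).indicator (fun x => nu d k T σ * pDensity d k σ x) x := by
  have hZ := (integral_weight_pos hk hσ).ne'
  have h1 : (nu d k T σ)⁻¹ ≠ 0 := by
    rw [← genGaussian_closedBall hk hσ hT]
    exact (genGaussian_closedBall_pos hk hσ hT).ne'
  have h2 := integral_truncWeight_div hk hσ hT
  rw [← inv_inv (cdf _ _)] at h2
  change _ = (nu d k T σ)⁻¹ at h2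
  rw [div_eq_iff hZ] at h2
  rw [qDensity, h2, truncWeight]
  by_cases hx : x ∈ Metric.closedBall (0 : EuclideanSpace ℝ (Fin d)) T
  · rw [Set.indicator_of_mem hx, Set.indicator_of_mem hx, pDensity]
    have := inv_ne_zero h1
    rw [inv_inv] at this
    field_simp
  · rw [Set.indicator_of_notMem hx, Set.indicator_of_notMem hx, zero_div]

lemma truncGenGaussian_real (hk : 2 * k < d) (hσ : 0 < σ) {T : ℝ} (hT : 0 < T)
    (A : Set (EuclideanSpace ℝ (Fin d))) :
    (truncGenGaussian d k T σ).real A =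
      nu d k T σ * ((genGaussian d k σ).restrict (Metric.closedBall 0 T)).real A := by
  have hν : 0 ≤ nu d k T σ := by
    rw [← inv_nonneg, ← genGaussian_closedBall hk hσ hT]; exact measureReal_nonneg
  have hB := (Metric.isClosed_closedBall (x := (0 : EuclideanSpace ℝ (Fin d))) (ε := T)).measurableSet
  have h1 : (fun x => ENNReal.ofReal (qDensity d k T σ x)) =
      (Metric.closedBall 0 T).indicator
        (ENNReal.ofReal (nu d k T σ) • fun x => ENNReal.ofReal (pDensity d k σ x)) := by
    ext x
    rw [qDensity_eq hk hσ hT]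
    by_cases hx : x ∈ Metric.closedBall (0 : EuclideanSpace ℝ (Fin d)) T
    · rw [Set.indicator_of_mem hx, Set.indicator_of_mem hx, ENNReal.ofReal_mul hν]; rfl
    · rw [Set.indicator_of_notMem hx, Set.indicator_of_notMem hx, ENNReal.ofReal_zero]
  rw [truncGenGaussian, h1, withDensity_indicator hB,
    withDensity_smul _ measurable_pDensity.ennreal_ofReal, ← restrict_withDensity hB,
    measureReal_ennreal_smul_apply, ENNReal.toReal_ofReal hν]
  rfl

/-! ### Thresholds for the likelihood ratio on a connected region -/

lemma weight_eq_inv_invWeight (x : EuclideanSpace ℝ (Fin d)) :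
    weight d k σ x = (invWeight k (sigmaPrime d k σ) x)⁻¹ := by
  rw [weight, invWeight, Real.exp_neg, mul_inv]

/-- The likelihood ratio `p(x - δ) / p(x)`. -/
noncomputable def likelihoodRatio (d k : ℕ) (σ : ℝ) (δ x : EuclideanSpace ℝ (Fin d)) : ℝ :=
  invWeight k (sigmaPrime d k σ) x / invWeight k (sigmaPrime d k σ) (x - δ)

lemma nontrivial_euclideanSpace (hd : 0 < d) : Nontrivial (EuclideanSpace ℝ (Fin d)) := by
  have : Nonempty (Fin d) := ⟨⟨0, hd⟩⟩
  infer_instance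

lemma genGaussian_singleton (hk : 2 * k < d) (x : EuclideanSpace ℝ (Fin d)) :
    genGaussian d k σ {x} = 0 := by
  have := nontrivial_euclideanSpace (show 0 < d by omega)
  exact genGaussian_absolutelyContinuous (measure_singleton x)

/-- On a connected open region, exactly one likelihood-ratio threshold has a prescribed
probability strictly between `0` and the probability of the region. -/
lemma existsUnique_likelihoodRatio_threshold (hk : 2 * k < d) (hσ : 0 < σ)
    {δ : EuclideanSpace ℝ (Fin d)} (hδ : δ ≠ 0) {S : Set (EuclideanSpace ℝ (Fin d))}
    (hSo : IsOpen S) (hS : IsPreconnected S) {c : ℝ}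
    (hc : c ∈ Set.Ioo 0 ((genGaussian d k σ).real S)) :
    ∃! a, ((genGaussian d k σ).restrict S).real {x | likelihoodRatio d k σ δ x < a} = c := by
  have := isProbabilityMeasure_genGaussian hk hσ
  have hs := sigmaPrime_pos hk hσ
  set s := sigmaPrime d k σ with hsdef
  have hv : Continuous (invWeight k s : EuclideanSpace ℝ (Fin d) → ℝ) := continuous_invWeight k s
  have hvδ : Continuous fun x : EuclideanSpace ℝ (Fin d) => invWeight k s (x - δ) :=
    hv.comp (continuous_sub_right δ)
  -- The denominator of the ratio can vanish only at `δ`, a null point, so a set of positive mass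
  -- has a point where the ratio is genuine.
  have hexists : ∀ A : Set (EuclideanSpace ℝ (Fin d)), (genGaussian d k σ).restrict S A ≠ 0 →
      ∃ x ∈ S, x ∈ A ∧ 0 < invWeight k s (x - δ) := by
    intro A hA
    by_contra! h
    rw [Measure.restrict_apply' hSo.measurableSet] at hA
    refine hA (measure_mono_null (fun x hx => ?_) (genGaussian_singleton hk δ))
    by_contra hxδ
    exact (invWeight_pos k s (sub_ne_zero.2 hxδ)).not_ge (h x hx.2 hx.1)
  refine existsUnique_measureReal_sublevel _ (hv.measurable.div hvδ.measurable) ?_ ?_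
    (by rwa [measureReal_restrict_apply_univ])
  · intro a
    refine (Measure.restrict_le_self.absolutelyContinuous.trans
      genGaussian_absolutelyContinuous) ?_
    have := nontrivial_euclideanSpace (show 0 < d by omega)
    refine compl_mem_ae_iff.1 ?_
    filter_upwards [ae_invWeight_ne volume k hs hδ a,
      compl_mem_ae_iff.2 (measure_singleton δ)] with x hx hxδ hxa
    have hpos := invWeight_pos k s (sub_ne_zero.2 hxδ)
    exact hx ((div_eq_iff hpos.ne').1 hxa)
  · intro a b hab ha hb
    obtain ⟨y, hyS, hya, hy⟩ := hexists _ ha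
    obtain ⟨z, hzS, hzb, hz⟩ := hexists _ hb
    -- Cross-multiplied forms of `r < b` and `a < r`, open even at `δ`. They cover `S` because `a <
    -- b`, and both meet it, so by connectedness they overlap in a nonempty open subset of `S`,
    -- which has positive mass.
    have hU₁ : IsOpen {x : EuclideanSpace ℝ (Fin d) | invWeight k s x < b * invWeight k s (x - δ)} :=
      isOpen_lt hv (continuous_const.mul hvδ)
    have hU₂ : IsOpen {x : EuclideanSpace ℝ (Fin d) | a * invWeight k s (x - δ) < invWeight k s x} :=
      isOpen_lt (continuous_const.mul hvδ) hv
    have hne := hS _ _ hU₁ hU₂ (fun x _ => ?_) ⟨y, hyS, ?_⟩ ⟨z, hzS, ?_⟩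
    · have hpos := measure_genGaussian_pos_of_isOpen hk hσ (hSo.inter (hU₁.inter hU₂)) hne
      refine fun h => hpos (measure_mono_null ?_
        (by rwa [Measure.restrict_apply' hSo.measurableSet] at h))
      rintro x ⟨hxS, hx₁, hx₂⟩
      have hx₁ : invWeight k s x < b * invWeight k s (x - δ) := hx₁
      have hx₂ : a * invWeight k s (x - δ) < invWeight k s x := hx₂
      have h0 : 0 < invWeight k s (x - δ) := by
        refine (invWeight_nonneg k s _).lt_of_ne fun h0 => ?_
        rw [← h0, mul_zero] at hx₁
        exact (invWeight_nonneg k s x).not_gt hx₁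
      exact ⟨⟨(le_div_iff₀ h0).2 hx₂.le, (div_lt_iff₀ h0).2 hx₁⟩, hxS⟩
    · rcases (invWeight_nonneg k s (x - δ)).eq_or_lt with h0 | hpos
      · right
        have hxδ : x = δ := by
          by_contra hxδ
          exact (invWeight_pos k s (sub_ne_zero.2 hxδ)).ne h0
        change a * invWeight k s (x - δ) < invWeight k s x
        rw [← h0, mul_zero, hxδ]
        exact invWeight_pos k s hδ
      · rcases lt_or_ge (invWeight k s x) (b * invWeight k s (x - δ)) with h | h
        · exact Or.inl h
        · exact Or.inr ((mul_lt_mul_of_pos_right hab hpos).trans_le h)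
    · exact ((div_lt_iff₀ hy).1 hya).trans (mul_lt_mul_of_pos_right hab hy)
    · exact (mul_lt_mul_of_pos_right hab hz).trans_le ((le_div_iff₀ hz).1 hzb)

lemma pDensity_lt_iff (hk : 2 * k < d) (hσ : 0 < σ) {δ x : EuclideanSpace ℝ (Fin d)} (hx : x ≠ 0)
    (hxδ : x ≠ δ) (c : ℝ) :
    pDensity d k σ (x - δ) < c * pDensity d k σ x ↔ likelihoodRatio d k σ δ x < c := by
  have h1 := invWeight_pos k (sigmaPrime d k σ) hx
  have h2 := invWeight_pos k (sigmaPrime d k σ) (sub_ne_zero.2 hxδ)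
  rw [pDensity, pDensity, ← mul_div_assoc, div_lt_div_iff_of_pos_right (integral_weight_pos hk hσ),
    weight_eq_inv_invWeight, weight_eq_inv_invWeight, likelihoodRatio, ← div_eq_mul_inv,
    lt_div_iff₀ h1, inv_mul_eq_div]

lemma restrict_event (hk : 2 * k < d) (hσ : 0 < σ) {T : ℝ} (δ : EuclideanSpace ℝ (Fin d))
    {S : Set (EuclideanSpace ℝ (Fin d))} (hS : MeasurableSet S) {l₁ l₂ c : ℝ}
    (h : ∀ x ∈ S, l₁ * pDensity d k σ x + l₂ * qDensity d k T σ x = c * pDensity d k σ x) :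
    ((genGaussian d k σ).restrict S).real (event d k T σ δ l₁ l₂) =
      ((genGaussian d k σ).restrict S).real {x | likelihoodRatio d k σ δ x < c} := by
  refine measureReal_congr ?_
  have h0 : ∀ y, ∀ᵐ x ∂(genGaussian d k σ).restrict S, x ≠ y := fun y =>
    ae_restrict_of_ae (compl_mem_ae_iff.2 (genGaussian_singleton hk y))
  filter_upwards [h0 0, h0 δ, ae_restrict_mem hS] with x hx hxδ hxS
  refine propext ?_
  change pDensity d k σ (x - δ) < _ ↔ likelihoodRatio d k σ δ x < c
  rw [h x hxS, pDensity_lt_iff hk hσ hx hxδ]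

end DSRS

/-! ### Decoupling the two constraints -/

theorem mainTheorem11 (d k : ℕ) (hd : 2 ≤ d) (hk : 2 * k < d) (σ T : ℝ) (hσ : 0 < σ) (hT : 0 < T)
    (δ : EuclideanSpace ℝ (Fin d)) (hδ : δ ≠ 0) (PA QA : ℝ) (hQA : QA ∈ Set.Ioo (0 : ℝ) 1)
    (hPA : PA ∈ Set.Ioo (QA / DSRS.nu d k T σ) (1 - (1 - QA) / DSRS.nu d k T σ)) :
    ∃! l : ℝ × ℝ,
      DSRS.constraintP d k T σ δ l.1 l.2 = PA ∧ DSRS.constraintQ d k T σ δ l.1 l.2 = QA := by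
  open DSRS in
  have := isProbabilityMeasure_genGaussian hk hσ
  have := nontrivial_euclideanSpace (show 0 < d by omega)
  set B := Metric.closedBall (0 : EuclideanSpace ℝ (Fin d)) T with hB
  have hBm : MeasurableSet B := Metric.isClosed_closedBall.measurableSet
  -- The sphere is null, so the threshold found on the open ball serves for `B`.
  have hballB : Metric.ball (0 : EuclideanSpace ℝ (Fin d)) T =ᵐ[genGaussian d k σ] B := by
    refine genGaussian_absolutelyContinuous.ae_eq ?_
    refine Metric.ball_subset_closedBall.eventuallyLE.antisymm ?_
    rw [ae_le_set, Metric.closedBall_sdiff_ball, Measure.addHaar_sphere]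
  have hm := genGaussian_closedBall hk hσ hT
  have hmpos := genGaussian_closedBall_pos hk hσ hT
  rw [← hB] at hm hmpos
  have hν : 0 < nu d k T σ := by rw [← inv_pos, ← hm]; exact hmpos
  set ν := nu d k T σ
  have hmc : (genGaussian d k σ).real Bᶜ = 1 - ν⁻¹ := by
    rw [probReal_compl_eq_one_sub hBm, hm]
  have hrank : 1 < Module.rank ℝ (EuclideanSpace ℝ (Fin d)) := by
    rw [← Module.finrank_eq_rank, finrank_euclideanSpace_fin]; exact_mod_cast hd
  obtain ⟨a, ha, ha'⟩ := existsUnique_likelihoodRatio_threshold hk hσ hδ Metric.isOpen_ball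
    (convex_ball (0 : EuclideanSpace ℝ (Fin d)) T).isPreconnected (c := QA / ν) (by
      rw [measureReal_congr hballB, hm]
      exact ⟨div_pos hQA.1 hν, by rw [div_eq_mul_inv]; nlinarith [hQA.2, inv_pos.2 hν]⟩)
  rw [Measure.restrict_congr_set hballB] at ha
  simp only [Measure.restrict_congr_set hballB] at ha'
  obtain ⟨b, hb, hb'⟩ := existsUnique_likelihoodRatio_threshold hk hσ hδ
    Metric.isClosed_closedBall.isOpen_compl (isPreconnected_compl_closedBall hrank hT.le)
    (c := PA - QA / ν) (by
      rw [← hB, hmc]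
      have h1 := hPA.1
      have h2 := hPA.2
      rw [sub_div, one_div] at h2
      exact ⟨by linarith, by linarith⟩)
  rw [← hB] at hb
  simp only [← hB] at hb'
  have hin : ∀ l₁ l₂, ((genGaussian d k σ).restrict B).real (event d k T σ δ l₁ l₂) =
      ((genGaussian d k σ).restrict B).real {x | likelihoodRatio d k σ δ x < l₁ + l₂ * ν} := by
    refine fun l₁ l₂ => restrict_event hk hσ δ hBm fun x hx => ?_
    rw [qDensity_eq hk hσ hT, Set.indicator_of_mem hx]; ring
  have hout : ∀ l₁ l₂, ((genGaussian d k σ).restrict Bᶜ).real (event d k T σ δ l₁ l₂) =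
      ((genGaussian d k σ).restrict Bᶜ).real {x | likelihoodRatio d k σ δ x < l₁} := by
    refine fun l₁ l₂ => restrict_event hk hσ δ hBm.compl fun x hx => ?_
    rw [qDensity_eq hk hσ hT, Set.indicator_of_notMem hx]; ring
  -- The constraints become a triangular linear system in `(l₁, l₂)`, invertible since `ν ≠ 0`.
  have key : ∀ l₁ l₂, (constraintP d k T σ δ l₁ l₂ = PA ∧ constraintQ d k T σ δ l₁ l₂ = QA) ↔
      l₁ = b ∧ l₁ + l₂ * ν = a := by
    intro l₁ l₂
    have hP : constraintP d k T σ δ l₁ l₂ =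
        ((genGaussian d k σ).restrict B).real {x | likelihoodRatio d k σ δ x < l₁ + l₂ * ν} +
        ((genGaussian d k σ).restrict Bᶜ).real {x | likelihoodRatio d k σ δ x < l₁} := by
      rw [← hin l₁ l₂, ← hout l₁ l₂, ← measureReal_add_apply, Measure.restrict_add_restrict_compl hBm]
      rfl
    have hQ : constraintQ d k T σ δ l₁ l₂ =
        ν * ((genGaussian d k σ).restrict B).real {x | likelihoodRatio d k σ δ x < l₁ + l₂ * ν} := by
      rw [← hin l₁ l₂, ← truncGenGaussian_real hk hσ hT]
      rfl
    rw [hP, hQ, mul_comm ν, ← eq_div_iff hν.ne']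
    constructor
    · rintro ⟨h1, h2⟩
      rw [h2] at h1
      exact ⟨hb' _ (by linarith), ha' _ h2⟩
    · rintro ⟨rfl, h2⟩
      rw [h2, ha, hb]
      exact ⟨by ring, rfl⟩
  refine ⟨(b, (a - b) / ν), (key _ _).2 ⟨rfl, ?_⟩, ?_⟩
  · rw [div_mul_cancel₀ _ hν.ne']; ring
  · rintro ⟨l₁, l₂⟩ h
    obtain ⟨rfl, h2⟩ := (key _ _).1 h
    rw [← h2]
    ext
    · rfl
    · field_simp; simp
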